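/- Let $\mathbb C$ be a pointed variety of universal algebras: it has a constant $0$, and $f(0,\dots,0)=0$ holds in $\mathbb C$ for every basic operation $f$. Assume that $\mathbb C$ is semi-abelian, i.e. that the Split Short Five Lemma holds in $\mathbb C$ (a variety being automatically complete, cocomplete and Barr exact), or that it is classically ideal determined, i.e. that for some $n$ there are binary terms $s_1,\dots,s_n$ and an $(n+1)$-ary term $t$ such that $s_i(x,x)=0$ and $t(s_1(x,y),\dots,s_n(x,y),y)=x$ hold in $\mathbb C$ (these two conditions are known to be equivalent). Let $A$ be an algebra in $\mathbb C$ and let $X,Y$ be subalgebras of $A$. A term $t(\mathbf w_1,\dots,\mathbf w_k,\mathbf x_1,\dots,\mathbf x_m,\mathbf y_1,\dots,\mathbf y_n)$ in pairwise distinct variables is a commutator term if the identities $$t(\mathbf w_1,\dots,\mathbf w_k,0,\dots,0,\mathbf y_1,\dots,\mathbf y_n)=0=t(\mathbf w_1,\dots,\mathbf w_k,\mathbf x_1,\dots,\mathbf x_m,0,\dots,0)$$ hold in $\mathbb C$. Let $[X,Y]_{\mathbb C,A}$ be the set of all elements $t_A(w_1,\dots,w_k,x_1,\dots,x_m,y_1,\dots,y_n)$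 of $A$ with $k,m,n\ge 0$, $t$ such a commutator term, $w_i\in A$, $x_i\in X$ and $y_i\in Y$. Writing $+$ for coproducts in $\mathbb C$, $\iota_i$ for coproduct injections and $x\colon X\to A$, $y\colon Y\to A$ for the inclusions, let the $1$-weighted subobject commutator $[X,Y]_{A\mid 1}$ be the image under $[1_A,x,y]\colon A+X+Y\to A$ of the kernel of the canonical morphism $$\langle[\iota_1,\iota_2,0],[\iota_1,0,\iota_2]\rangle\colon A+X+Y\to (A+X)\times_A(A+Y),$$ where the pullback is that of $[1,0]\colon A+X\to A$ and $[1,0]\colon A+Y\to A$. Then $[X,Y]_{\mathbb C,A}=[X,Y]_{A\mid 1}$. -/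

import Mathlib

universe u v w w₁ w₂ w₃

/-- A pointed variety of universal algebras over the signature `L` (a first-order language without
relation symbols): a constant symbol `zero` and a set of identities in countably many variables.
The identities defining the variety are those in `eqns`, together with `f (0, …, 0) = 0` for all
operation symbols `f` (so that `0` is the only constant, that is, the one-element algebra is a zero
object). -/
structure PointedVariety (L : FirstOrder.Language.{u, v}) where
  /-- the zero constant -/
  zero : L.Constants
  /-- the identities, as pairs of terms -/
  eqns : Set (L.Term ℕ × L.Term ℕ)

namespace PointedVariety

set_option linter.unusedSectionVars false

open FirstOrder FirstOrder.Language

variable {L : FirstOrder.Language.{u, v}} (V : PointedVariety L)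

/-- `M` is an algebra of the pointed variety `V`. -/
class IsAlgebra (M : Type w) [L.Structure M] : Prop where
  realize_eq : ∀ e ∈ V.eqns, ∀ a : ℕ → M, e.1.realize a = e.2.realize a
  funMap_zero : ∀ {n : ℕ} (f : L.Functions n),
    Structure.funMap f (fun _ => (V.zero : M)) = (V.zero : M)

/-! ### Semi-abelian and classically ideal determined varieties -/

/-- The pointed variety `V` is semi-abelian. A variety has all limits and colimits and is
Barr exact, so for a pointed variety this amounts to Bourn protomodularity, that is, to the
Split Short Five Lemma: given two split epimorphisms `(p, s)`, `(p', s')` and a morphism `(a, b)`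
between them, if `b` is an isomorphism and `a` induces an isomorphism of the kernels of `p` and
`p'`, then `a` is an isomorphism. -/
def IsSemiAbelian : Prop :=
  ∀ (A B A' B' : Type w) [L.Structure A] [L.Structure B] [L.Structure A'] [L.Structure B']
    [V.IsAlgebra A] [V.IsAlgebra B] [V.IsAlgebra A'] [V.IsAlgebra B']
    (p : A →[L] B) (s : B →[L] A) (p' : A' →[L] B') (s' : B' →[L] A')
    (a : A →[L] A') (b : B →[L] B'),
    (∀ z, p (s z) = z) → (∀ z, p' (s' z) = z) →
    (∀ z, p' (a z) = b (p z)) → (∀ z, a (s z) = s' (b z)) →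
    Function.Bijective b →
    Set.BijOn a {z | p z = (V.zero : B)} {z | p' z = (V.zero : B')} →
    Function.Bijective a

/-- The pointed variety `V` is classically ideal determined: there are binary terms `s₁, …, sₙ`
and an `(n + 1)`-ary term `t` such that the identities `sᵢ (x, x) = 0` and
`t (s₁ (x, y), …, sₙ (x, y), y) = x` hold in `V`. -/
def IsClassicallyIdealDetermined : Prop :=
  ∃ (n : ℕ) (s : Fin n → L.Term (Fin 2)) (t : L.Term (Fin n ⊕ Unit)),
    ∀ (M : Type w) [L.Structure M] [V.IsAlgebra M],
      (∀ (i : Fin n) (x : M), (s i).realize ![x, x] = (V.zero : M)) ∧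
      ∀ x y : M, t.realize (Sum.elim (fun i => (s i).realize ![x, y]) (fun _ => y)) = x

/-! ### The commutator defined by commutator terms -/

/-- The term `t` in variables `𝐰₁, …, 𝐰ₖ`, `𝐱₁, …, 𝐱ₘ`, `𝐲₁, …, 𝐲ₙ` is a commutator term in
`(𝐱₁, …, 𝐱ₘ)` and `(𝐲₁, …, 𝐲ₙ)`: the identities `t (𝐰, 0, 𝐲) = 0 = t (𝐰, 𝐱, 0)` hold in `V`. -/
def IsCommutatorTerm {k m n : ℕ} (t : L.Term (Fin k ⊕ (Fin m ⊕ Fin n))) : Prop :=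
  ∀ (M : Type w) [L.Structure M] [V.IsAlgebra M]
    (c : Fin k → M) (a : Fin m → M) (b : Fin n → M),
    t.realize (Sum.elim c (Sum.elim (fun _ => (V.zero : M)) b)) = (V.zero : M) ∧
    t.realize (Sum.elim c (Sum.elim a (fun _ => (V.zero : M)))) = (V.zero : M)

/-- The commutator `[X, Y]_{V, A}`: all values `t (w₁, …, wₖ, x₁, …, xₘ, y₁, …, yₙ)` of commutator
terms `t` at elements `wᵢ` of `A`, `xᵢ` of `X` and `yᵢ` of `Y`. -/
def termCommutator {A : Type w} [L.Structure A] (X Y : L.Substructure A) : Set A :=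
  {z | ∃ (k m n : ℕ) (t : L.Term (Fin k ⊕ (Fin m ⊕ Fin n))) (c : Fin k → A) (a : Fin m → A)
    (b : Fin n → A), IsCommutatorTerm.{u, v, w} V t ∧ (∀ i, a i ∈ X) ∧ (∀ i, b i ∈ Y) ∧
      z = t.realize (Sum.elim c (Sum.elim a b))}

/-! ### Kernels, zero morphisms, pullbacks -/

instance (A : Type w) [L.Structure A] [V.IsAlgebra A] (S : L.Substructure A) : V.IsAlgebra S where
  realize_eq e he a := by
    apply S.subtype.injective
    have h := IsAlgebra.realize_eq (V := V) e he (fun i => S.subtype (a i))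
    rw [← HomClass.realize_term S.subtype, ← HomClass.realize_term S.subtype]
    exact h
  funMap_zero f := by
    apply S.subtype.injective
    rw [HomClass.map_fun S.subtype, HomClass.map_constants S.subtype]
    refine Eq.trans ?_ (IsAlgebra.funMap_zero (V := V) (M := A) f)
    congr 1
    funext i
    exact HomClass.map_constants S.subtype V.zero

/-- The kernel of a homomorphism. -/
def ker {M : Type w₁} {N : Type w₂} [L.Structure M] [L.Structure N] [V.IsAlgebra N]
    (h : M →[L] N) : L.Substructure M where
  carrier := {z | h z = (V.zero : N)}
  fun_mem f xs hxs := by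
    have e : (h ∘ xs) = fun _ => (V.zero : N) := funext hxs
    change h _ = _
    rw [Hom.map_fun, e, IsAlgebra.funMap_zero]

variable [L.IsAlgebraic]

/-- The zero morphism. -/
def zeroHom (M : Type w₁) (N : Type w₂) [L.Structure M] [L.Structure N] [V.IsAlgebra N] :
    M →[L] N where
  toFun _ := (V.zero : N)
  map_fun' f _ := (IsAlgebra.funMap_zero f).symm
  map_rel' r := isEmptyElim r

/-- The pullback of two homomorphisms, as a subalgebra of the cartesian product. -/
def Pullback {M : Type w₁} {N : Type w₂} {P : Type w₃} [L.Structure M] [L.Structure N]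
    [L.Structure P] (f : M →[L] P) (g : N →[L] P) : Type (max w₁ w₂) :=
  {z : M × N // f z.1 = g z.2}

section Pullback

variable {M : Type w₁} {N : Type w₂} {P : Type w₃} [L.Structure M] [L.Structure N]
  [L.Structure P] (f : M →[L] P) (g : N →[L] P)

instance : L.Structure (Pullback f g) where
  funMap o xs := ⟨(Structure.funMap o fun i => (xs i).1.1, Structure.funMap o fun i => (xs i).1.2),
    by
      rw [Hom.map_fun, Hom.map_fun]
      congr 1
      funext i
      exact (xs i).2⟩
  RelMap r := isEmptyElim r

/-- The first projection. -/
def Pullback.fst : Pullback f g →[L] M where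
  toFun z := z.1.1
  map_fun' _ _ := rfl
  map_rel' r := isEmptyElim r

/-- The second projection. -/
def Pullback.snd : Pullback f g →[L] N where
  toFun z := z.1.2
  map_fun' _ _ := rfl
  map_rel' r := isEmptyElim r

instance [V.IsAlgebra M] [V.IsAlgebra N] : V.IsAlgebra (Pullback f g) where
  realize_eq e he a := by
    refine Subtype.ext (Prod.ext ?_ ?_)
    · change Pullback.fst f g _ = Pullback.fst f g _
      rw [← HomClass.realize_term, ← HomClass.realize_term]
      exact IsAlgebra.realize_eq (V := V) e he _
    · change Pullback.snd f g _ = Pullback.snd f g _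
      rw [← HomClass.realize_term, ← HomClass.realize_term]
      exact IsAlgebra.realize_eq (V := V) e he _
  funMap_zero o := by
    refine Subtype.ext (Prod.ext ?_ ?_)
    · change Pullback.fst f g (Structure.funMap o fun _ => (V.zero : Pullback f g))
        = Pullback.fst f g (V.zero : Pullback f g)
      rw [Hom.map_fun, HomClass.map_constants (Pullback.fst f g)]
      refine Eq.trans ?_ (IsAlgebra.funMap_zero (V := V) (M := M) o)
      congr 1
      funext i
      exact HomClass.map_constants (Pullback.fst f g) V.zero
    · change Pullback.snd f g (Structure.funMap o fun _ => (V.zero : Pullback f g))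
        = Pullback.snd f g (V.zero : Pullback f g)
      rw [Hom.map_fun, HomClass.map_constants (Pullback.snd f g)]
      refine Eq.trans ?_ (IsAlgebra.funMap_zero (V := V) (M := N) o)
      congr 1
      funext i
      exact HomClass.map_constants (Pullback.snd f g) V.zero

/-- The morphism `⟨h₁, h₂⟩` into the pullback. -/
def Pullback.lift {Q : Type w} [L.Structure Q] (h₁ : Q →[L] M) (h₂ : Q →[L] N)
    (h : ∀ z, f (h₁ z) = g (h₂ z)) : Q →[L] Pullback f g where
  toFun z := ⟨(h₁ z, h₂ z), h z⟩
  map_fun' o xs := Subtype.ext (Prod.ext (h₁.map_fun o xs) (h₂.map_fun o xs))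
  map_rel' r := isEmptyElim r

end Pullback

/-! ### Binary coproducts -/

section Coprod

variable (M : Type w₁) (N : Type w₂) [L.Structure M] [L.Structure N]

/-- The congruence on the term algebra on `M ⊔ N` generated by the operation tables of `M` and `N`
and by the identities of `V`. -/
inductive CoprodRel : L.Term (M ⊕ N) → L.Term (M ⊕ N) → Prop
  | refl (t) : CoprodRel t t
  | symm {t t'} : CoprodRel t t' → CoprodRel t' t
  | trans {t t' t''} : CoprodRel t t' → CoprodRel t' t'' → CoprodRel t t''
  | congr {n : ℕ} (f : L.Functions n) (ts ts' : Fin n → L.Term (M ⊕ N)) :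
      (∀ i, CoprodRel (ts i) (ts' i)) → CoprodRel (Term.func f ts) (Term.func f ts')
  | inl {n : ℕ} (f : L.Functions n) (xs : Fin n → M) :
      CoprodRel (Term.func f fun i => Term.var (Sum.inl (xs i)))
        (Term.var (Sum.inl (Structure.funMap f xs)))
  | inr {n : ℕ} (f : L.Functions n) (ys : Fin n → N) :
      CoprodRel (Term.func f fun i => Term.var (Sum.inr (ys i)))
        (Term.var (Sum.inr (Structure.funMap f ys)))
  | eqn (e : L.Term ℕ × L.Term ℕ) (he : e ∈ V.eqns) (σ : ℕ → L.Term (M ⊕ N)) :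
      CoprodRel (e.1.subst σ) (e.2.subst σ)
  | zero {n : ℕ} (f : L.Functions n) :
      CoprodRel (Term.func f fun _ => Constants.term V.zero) (Constants.term V.zero)

/-- `CoprodRel` as a setoid. -/
def coprodSetoid : Setoid (L.Term (M ⊕ N)) :=
  ⟨CoprodRel V M N, CoprodRel.refl, CoprodRel.symm, CoprodRel.trans⟩

/-- The coproduct `M + N` in the variety `V`. -/
def Coprod : Type (max u w₁ w₂) := Quotient (coprodSetoid V M N)

variable {M N}

/-- The class of a term in the coproduct. -/
def Coprod.mk (t : L.Term (M ⊕ N)) : V.Coprod M N := Quotient.mk (coprodSetoid V M N) t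

noncomputable instance : L.Structure (V.Coprod M N) where
  funMap f xs := Coprod.mk V (Term.func f fun i => Quotient.out (xs i))
  RelMap r := isEmptyElim r

theorem Coprod.funMap_mk {n : ℕ} (f : L.Functions n) (ts : Fin n → L.Term (M ⊕ N)) :
    Structure.funMap f (fun i => Coprod.mk V (ts i)) = Coprod.mk V (Term.func f ts) := by
  refine Quotient.sound (s := coprodSetoid V M N) (CoprodRel.congr f _ _ fun i => ?_)
  exact Quotient.exact (s := coprodSetoid V M N) (Quotient.out_eq _)

theorem Coprod.zero_eq : ((V.zero : L.Constants) : V.Coprod M N)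
    = Coprod.mk V (Constants.term V.zero) := by
  refine Eq.trans ?_ (Coprod.funMap_mk V V.zero default)
  exact congrArg (Structure.funMap (M := V.Coprod M N) V.zero) (Subsingleton.elim _ _)

theorem Coprod.realize_mk {α : Type w} (t : L.Term α) (σ : α → L.Term (M ⊕ N)) :
    t.realize (fun i => Coprod.mk V (σ i)) = Coprod.mk V (t.subst σ) := by
  induction t with
  | var i => rfl
  | func f ts ih =>
    simp only [Term.realize_func, ih, Coprod.funMap_mk, Term.subst]

instance : V.IsAlgebra (V.Coprod M N) where
  realize_eq e he a := by
    have h : a = fun i => Coprod.mk V (Quotient.out (a i)) :=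
      funext fun i => (Quotient.out_eq (a i)).symm
    rw [h, Coprod.realize_mk, Coprod.realize_mk]
    exact Quotient.sound (s := coprodSetoid V M N) (CoprodRel.eqn e he _)
  funMap_zero f := by
    rw [Coprod.zero_eq, Coprod.funMap_mk]
    exact Quotient.sound (s := coprodSetoid V M N) (CoprodRel.zero f)

variable (M N)

/-- The first coproduct injection. -/
def Coprod.inl : M →[L] V.Coprod M N where
  toFun z := Coprod.mk V (Term.var (Sum.inl z))
  map_fun' f xs := by
    refine Eq.trans ?_ (Coprod.funMap_mk V f fun i => Term.var (Sum.inl (xs i))).symm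
    exact (Quotient.sound (s := coprodSetoid V M N) (CoprodRel.inl f xs)).symm
  map_rel' r := isEmptyElim r

/-- The second coproduct injection. -/
def Coprod.inr : N →[L] V.Coprod M N where
  toFun z := Coprod.mk V (Term.var (Sum.inr z))
  map_fun' f xs := by
    refine Eq.trans ?_ (Coprod.funMap_mk V f fun i => Term.var (Sum.inr (xs i))).symm
    exact (Quotient.sound (s := coprodSetoid V M N) (CoprodRel.inr f xs)).symm
  map_rel' r := isEmptyElim r

variable {M N} {P : Type w₃} [L.Structure P] [V.IsAlgebra P]

theorem CoprodRel.realize_eq (f : M →[L] P) (g : N →[L] P) {t t' : L.Term (M ⊕ N)}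
    (h : CoprodRel V M N t t') :
    t.realize (Sum.elim f g) = t'.realize (Sum.elim f g) := by
  induction h with
  | refl t => rfl
  | symm _ ih => exact ih.symm
  | trans _ _ ih ih' => exact ih.trans ih'
  | congr o ts ts' _ ih => simp only [Term.realize_func, ih]
  | inl o xs => exact (f.map_fun o xs).symm
  | inr o ys => exact (g.map_fun o ys).symm
  | eqn e he σ =>
    rw [Term.realize_subst, Term.realize_subst]
    exact IsAlgebra.realize_eq e he _
  | zero o =>
    simp only [Term.realize_func, Term.realize_constants]
    exact IsAlgebra.funMap_zero o

/-- The morphism `[f, g] : M + N → P`. -/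
def Coprod.desc (f : M →[L] P) (g : N →[L] P) : V.Coprod M N →[L] P where
  toFun := Quotient.lift (s := coprodSetoid V M N) (fun t => t.realize (Sum.elim f g))
    fun _ _ h => CoprodRel.realize_eq V f g h
  map_fun' o xs := by
    have h : xs = fun i => Coprod.mk V (Quotient.out (xs i)) :=
      funext fun i => (Quotient.out_eq (xs i)).symm
    rw [h, Coprod.funMap_mk]
    rfl
  map_rel' r := isEmptyElim r

@[simp] theorem Coprod.desc_inl (f : M →[L] P) (g : N →[L] P) (z : M) :
    Coprod.desc V f g (Coprod.inl V M N z) = f z := rfl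

@[simp] theorem Coprod.desc_inr (f : M →[L] P) (g : N →[L] P) (z : N) :
    Coprod.desc V f g (Coprod.inr V M N z) = g z := rfl

/-- Together with `Coprod.desc`, this is the universal property of the coproduct. -/
theorem Coprod.hom_ext {Q : Type w} [L.Structure Q] {h h' : V.Coprod M N →[L] Q}
    (hl : ∀ z, h (Coprod.inl V M N z) = h' (Coprod.inl V M N z))
    (hr : ∀ z, h (Coprod.inr V M N z) = h' (Coprod.inr V M N z)) : h = h' := by
  ext c
  induction c using Quotient.inductionOn with
  | h t =>
    change h (Coprod.mk V t) = h' (Coprod.mk V t)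
    induction t with
    | var i =>
      rcases i with z | z
      · exact hl z
      · exact hr z
    | func f ts ih =>
      rw [← Coprod.funMap_mk, Hom.map_fun, Hom.map_fun]
      exact congrArg _ (funext ih)

end Coprod

/-! ### The weighted subobject commutator -/

section Weighted

variable (W : Type w₁) (X : Type w₂) (Y : Type w₃) [L.Structure W] [L.Structure X] [L.Structure Y]
  [V.IsAlgebra W]

/-- The morphism `[1, 0] : W + X → W`. -/
noncomputable def retraction : V.Coprod W X →[L] W := Coprod.desc V (Hom.id L W) (V.zeroHom X W)

/-- The morphism `[ι₁, ι₂, 0] : W + X + Y → W + X`. -/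
noncomputable def toCoprodLeft : V.Coprod (V.Coprod W X) Y →[L] V.Coprod W X :=
  Coprod.desc V (Hom.id L (V.Coprod W X)) (V.zeroHom Y (V.Coprod W X))

/-- The morphism `[ι₁, 0, ι₂] : W + X + Y → W + Y`. -/
noncomputable def toCoprodRight : V.Coprod (V.Coprod W X) Y →[L] V.Coprod W Y :=
  Coprod.desc V (Coprod.desc V (Coprod.inl V W Y) (V.zeroHom X (V.Coprod W Y)))
    (Coprod.inr V W Y)

theorem retraction_toCoprod (c : V.Coprod (V.Coprod W X) Y) :
    V.retraction W X (V.toCoprodLeft W X Y c) = V.retraction W Y (V.toCoprodRight W X Y c) := by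
  have h : (V.retraction W X).comp (V.toCoprodLeft W X Y)
      = (V.retraction W Y).comp (V.toCoprodRight W X Y) := by
    refine Coprod.hom_ext V (fun z => ?_) (fun z => ?_)
    · refine DFunLike.congr_fun (f := ((V.retraction W X).comp (V.toCoprodLeft W X Y)).comp
        (Coprod.inl V _ Y)) (g := ((V.retraction W Y).comp (V.toCoprodRight W X Y)).comp
        (Coprod.inl V _ Y)) (Coprod.hom_ext V (fun z => rfl) (fun z => ?_)) z
      exact (HomClass.map_constants (V.retraction W Y) V.zero).symm
    · exact HomClass.map_constants (V.retraction W X) V.zero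
  exact DFunLike.congr_fun h c

/-- The canonical morphism `⟨[ι₁, ι₂, 0], [ι₁, 0, ι₂]⟩ : W + X + Y → (W + X) ×_W (W + Y)`. -/
noncomputable def canonical : V.Coprod (V.Coprod W X) Y →[L]
    Pullback (V.retraction W X) (V.retraction W Y) :=
  Pullback.lift _ _ (V.toCoprodLeft W X Y) (V.toCoprodRight W X Y) (V.retraction_toCoprod W X Y)

variable {W X Y} {A : Type w} [L.Structure A] [V.IsAlgebra A]

/-- The `(W, w)`-weighted subobject commutator `[(X, x), (Y, y)]_{(W, w)}`: the image under
`[w, x, y] : W + X + Y → A` of the kernel of the canonical morphism. -/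
noncomputable def weightedCommutator (w : W →[L] A) (x : X →[L] A) (y : Y →[L] A) : L.Substructure A :=
  (V.ker (V.canonical W X Y)).map (Coprod.desc V (Coprod.desc V w x) y)

end Weighted

/-- The `1`-weighted subobject commutator `[X, Y]_{A | 1}` of subalgebras `X`, `Y` of `A`. -/
noncomputable def oneWeightedCommutator {A : Type w} [L.Structure A] [V.IsAlgebra A] (X Y : L.Substructure A) :
    L.Substructure A :=
  V.weightedCommutator (Hom.id L A) X.subtype.toHom Y.subtype.toHom

end PointedVariety

namespace PointedVariety

open FirstOrder FirstOrder.Language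

/-! The terms `s i` act as subtractions and `T` as the operation undoing them: `s i` vanishes on the
diagonal, and an element `z` is recovered as `T` of the `s i (z, 0)` and `0`. A semi-abelian variety
has such terms (`IsSemiAbelian.isClassicallyIdealDetermined`): in the free algebra on `x, y`, the
kernel of the map identifying `x` with `y`, together with `y`, generates everything, in particular
`x`.

Values of commutator terms lie in the weighted commutator because their identities hold in `A + X`
and `A + Y`. Conversely, a kernel element of `A + X + Y` is a term value `t(c, a, b)`, but `t(c, a,
0)` and `t(c, 0, b)` vanish only for these particular arguments, not identically.
`exists_isCommutatorTerm` corrects `t` by a double difference over `t(w, x, y)`, `t(w, x, 0)`, `t(w,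
0, y)`, `t(w, 0, 0)`. The result is always a commutator term, and it keeps the value of `t` wherever
the last three vanish. -/

/-- Every term is obtained by renaming from a term in finitely many variables. -/
theorem exists_relabel_fin {L : FirstOrder.Language.{u, v}} {α : Type w} (t : L.Term α) :
    ∃ (n : ℕ) (e : Fin n → α) (t' : L.Term (Fin n)), t'.relabel e = t := by
  classical
  refine ⟨t.varFinset.card, fun i => (t.varFinset.equivFin.symm i : α),
    t.restrictVar (fun i => t.varFinset.equivFin i), ?_⟩
  -- Subterms have smaller variable sets, so the induction lets the index maps vary while the bound
  -- stays fixed.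
  suffices h : ∀ (s : L.Term α) (f : s.varFinset → Fin t.varFinset.card)
      (g : Fin t.varFinset.card → α), (∀ i, g (f i) = i) → (s.restrictVar f).relabel g = s from
    h t _ _ fun i => by simp
  intro s
  induction s with
  | var i => exact fun f g h => congrArg Term.var (h _)
  | func o ts ih =>
    intro f g h
    simp only [Term.restrictVar, Term.relabel]
    exact congrArg _ (funext fun i => ih i _ _ fun j => h _)

variable {L : FirstOrder.Language.{u, v}} (V : PointedVariety L)

/-! ### Free algebras -/

section FreeAlgebra

/-- Two terms are identified if they have the same values in all algebras of `V`. -/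
def freeSetoid (α : Type w₁) : Setoid (L.Term α) where
  r t t' := ∀ (M : Type w) [L.Structure M] [V.IsAlgebra M] (a : α → M), t.realize a = t'.realize a
  iseqv := ⟨fun _ _ _ _ _ => rfl, fun h M _ _ a => (h M a).symm,
    fun h h' M _ _ a => (h M a).trans (h' M a)⟩

/-- The free algebra on `α`, relative to algebras in the universe `w`. -/
def Free (α : Type w₁) : Type (max u w₁) := Quotient (freeSetoid.{u, v, w, w₁} V α)

variable {V} {α : Type w₁}

/-- The class of a term in the free algebra. -/
def Free.mk (t : L.Term α) : Free.{u, v, w, w₁} V α := Quotient.mk (freeSetoid V α) t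

theorem Free.mk_out (z : Free.{u, v, w, w₁} V α) :
    Free.mk (Quotient.out (s := freeSetoid V α) z) = z :=
  Quotient.out_eq (s := freeSetoid V α) z

variable [L.IsAlgebraic]

noncomputable instance : L.Structure (Free.{u, v, w, w₁} V α) where
  funMap f xs := Free.mk (Term.func f fun i => Quotient.out (s := freeSetoid V α) (xs i))
  RelMap r := isEmptyElim r

theorem Free.funMap_mk {n : ℕ} (f : L.Functions n) (ts : Fin n → L.Term α) :
    Structure.funMap f (fun i => (Free.mk (ts i) : Free.{u, v, w, w₁} V α))
      = Free.mk (Term.func f ts) := by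
  refine Quotient.sound (s := freeSetoid V α) fun M _ _ a => ?_
  simp only [Term.realize_func]
  exact congrArg _ (funext fun i =>
    Quotient.exact (s := freeSetoid.{u, v, w, w₁} V α) (Free.mk_out (Free.mk (ts i))) M a)

theorem Free.realize_mk {β : Type w₂} (t : L.Term β) (σ : β → L.Term α) :
    t.realize (fun i => (Free.mk (σ i) : Free.{u, v, w, w₁} V α)) = Free.mk (t.subst σ) := by
  induction t with
  | var i => rfl
  | func f ts ih => simp only [Term.realize_func, ih, Free.funMap_mk, Term.subst]

theorem Free.zero_eq : ((V.zero : L.Constants) : Free.{u, v, w, w₁} V α)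
    = Free.mk (Constants.term V.zero) := by
  refine Eq.trans ?_ (Free.funMap_mk V.zero default)
  exact congrArg (Structure.funMap (M := Free.{u, v, w, w₁} V α) V.zero) (Subsingleton.elim _ _)

instance : V.IsAlgebra (Free.{u, v, w, w₁} V α) where
  realize_eq e he a := by
    have h : a = fun i => Free.mk (Quotient.out (s := freeSetoid V α) (a i)) :=
      funext fun i => (Free.mk_out (a i)).symm
    rw [h, Free.realize_mk, Free.realize_mk]
    refine Quotient.sound (s := freeSetoid V α) fun M _ _ b => ?_
    rw [Term.realize_subst, Term.realize_subst]
    exact IsAlgebra.realize_eq e he _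
  funMap_zero f := by
    rw [Free.zero_eq, Free.funMap_mk]
    refine Quotient.sound (s := freeSetoid V α) fun M _ _ b => ?_
    simp only [Term.realize_func, Term.realize_constants]
    exact IsAlgebra.funMap_zero f

/-- The homomorphism from the free algebra extending a map on generators. -/
def Free.lift {M : Type w} [L.Structure M] [V.IsAlgebra M] (a : α → M) :
    Free.{u, v, w, w₁} V α →[L] M where
  toFun := Quotient.lift (s := freeSetoid V α) (fun t => t.realize a) fun _ _ h => h M a
  map_fun' o xs := by
    have h : xs = fun i => Free.mk (Quotient.out (s := freeSetoid V α) (xs i)) :=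
      funext fun i => (Free.mk_out (xs i)).symm
    rw [h, Free.funMap_mk]
    rfl
  map_rel' r := isEmptyElim r

theorem Free.lift_mk {M : Type w} [L.Structure M] [V.IsAlgebra M] (a : α → M) (t : L.Term α) :
    Free.lift a (Free.mk t : Free.{u, v, w, w₁} V α) = t.realize a := rfl

theorem Free.hom_ext {N : Type w₂} [L.Structure N] {h h' : Free.{u, v, w, w₁} V α →[L] N}
    (H : ∀ i, h (Free.mk (Term.var i)) = h' (Free.mk (Term.var i))) : h = h' := by
  ext c
  induction c using Quotient.inductionOn with
  | h t =>
    change h (Free.mk t) = h' (Free.mk t)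
    induction t with
    | var i => exact H i
    | func f ts ih =>
      rw [← Free.funMap_mk, Hom.map_fun, Hom.map_fun]
      exact congrArg _ (funext ih)

end FreeAlgebra

/-! ### Turning a term into a commutator term -/

/-- In a classically ideal determined variety, a term whose value becomes zero when its second or
its third group of arguments is replaced by zero has the same value as some commutator term. -/
theorem IsClassicallyIdealDetermined.exists_isCommutatorTerm
    (hV : IsClassicallyIdealDetermined.{u, v, w} V) {k m n : ℕ}
    (t : L.Term (Fin k ⊕ (Fin m ⊕ Fin n))) : ∃ t' : L.Term (Fin k ⊕ (Fin m ⊕ Fin n)),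
      IsCommutatorTerm.{u, v, w} V t' ∧
      ∀ (M : Type w) [L.Structure M] [V.IsAlgebra M]
        (c : Fin k → M) (a : Fin m → M) (b : Fin n → M),
        t.realize (Sum.elim c (Sum.elim (fun _ => (V.zero : M)) b)) = (V.zero : M) →
        t.realize (Sum.elim c (Sum.elim a (fun _ => (V.zero : M)))) = (V.zero : M) →
        t.realize (Sum.elim c (Sum.elim (fun _ => (V.zero : M)) (fun _ => (V.zero : M))))
          = (V.zero : M) →
        t'.realize (Sum.elim c (Sum.elim a b)) = t.realize (Sum.elim c (Sum.elim a b)) := by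
  obtain ⟨N, s, T, hsT⟩ := hV
  let o {α : Type} : L.Term α := Constants.term V.zero
  let σ (x : Fin m → L.Term (Fin k ⊕ (Fin m ⊕ Fin n)))
      (y : Fin n → L.Term (Fin k ⊕ (Fin m ⊕ Fin n))) : L.Term (Fin k ⊕ (Fin m ⊕ Fin n)) :=
    t.subst (Sum.elim (fun i => Term.var (Sum.inl i)) (Sum.elim x y))
  let x : Fin m → L.Term (Fin k ⊕ (Fin m ⊕ Fin n)) := fun i => Term.var (Sum.inr (Sum.inl i))
  let y : Fin n → L.Term (Fin k ⊕ (Fin m ⊕ Fin n)) := fun i => Term.var (Sum.inr (Sum.inr i))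
  -- The double difference: `s i` subtracts the value at `y = 0`, then `s j` subtracts the same
  -- expression taken at `x = 0`.
  let d (i j : Fin N) : L.Term (Fin k ⊕ (Fin m ⊕ Fin n)) :=
    (s j).subst ![(s i).subst ![σ x y, σ x fun _ => o],
      (s i).subst ![σ (fun _ => o) y, σ (fun _ => o) fun _ => o] ]
  -- Two applications of `T` undo the two subtractions, with `0` as the subtracted element.
  let r : L.Term (Fin k ⊕ (Fin m ⊕ Fin n)) :=
    T.subst (Sum.elim (fun i => T.subst (Sum.elim (d i) fun _ => o)) fun _ => o)
  have hr : ∀ (M : Type w) [L.Structure M] [V.IsAlgebra M]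
      (c : Fin k → M) (a : Fin m → M) (b : Fin n → M),
      r.realize (Sum.elim c (Sum.elim a b)) =
      T.realize (Sum.elim (fun i => T.realize (Sum.elim (fun j =>
        (s j).realize ![
          (s i).realize ![t.realize (Sum.elim c (Sum.elim a b)),
            t.realize (Sum.elim c (Sum.elim a (fun _ => (V.zero : M))))],
          (s i).realize ![t.realize (Sum.elim c (Sum.elim (fun _ => (V.zero : M)) b)),
            t.realize (Sum.elim c (Sum.elim (fun _ => (V.zero : M)) (fun _ => (V.zero : M))))] ])
          fun _ => (V.zero : M))) fun _ => (V.zero : M)) := by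
    intro M _ _ c a b
    have h2 : ∀ (p q : L.Term (Fin k ⊕ (Fin m ⊕ Fin n))) (v : _ → M),
        (fun i => (![p, q] i).realize v) = ![p.realize v, q.realize v] := by
      intro p q v
      funext i
      fin_cases i <;> rfl
    have hN : ∀ (p : Fin N → L.Term (Fin k ⊕ (Fin m ⊕ Fin n))) (v : _ → M),
        (fun i => (Sum.elim p (fun _ : Unit => o) i).realize v)
          = Sum.elim (fun i => (p i).realize v) fun _ => (V.zero : M) := by
      intro p v
      funext i
      rcases i with i | i
      · rfl
      · exact Term.realize_constants
    have h3 : ∀ (x y) (v : _ → M), (σ x y).realize v = t.realize (Sum.elim (fun i => v (Sum.inl i))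
        (Sum.elim (fun i => (x i).realize v) fun i => (y i).realize v)) := by
      intro x y v
      rw [Term.realize_subst]
      congr 1
      funext i
      rcases i with i | i | i <;> rfl
    simp only [r, d, Term.realize_subst, h2, hN, h3]
    simp only [x, y, o, Term.realize_var, Term.realize_constants, Sum.elim_inl, Sum.elim_inr]
  have hT : ∀ (M : Type w) [L.Structure M] [V.IsAlgebra M] (z : M),
      T.realize (Sum.elim (fun i => (s i).realize ![z, (V.zero : M)]) fun _ => (V.zero : M)) = z :=
    fun M _ _ z => (hsT M).2 z _
  have hT0 : ∀ (M : Type w) [L.Structure M] [V.IsAlgebra M],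
      T.realize (Sum.elim (fun _ => (V.zero : M)) fun _ => (V.zero : M)) = (V.zero : M) := by
    intro M _ _
    have := hT M V.zero
    simpa only [(hsT M).1] using this
  refine ⟨r, fun M _ _ c a b => ⟨?_, ?_⟩, fun M _ _ c a b h1 h2 h3 => ?_⟩
  -- At `x = 0` both arguments of each `s j` coincide.
  · simp only [hr, (hsT M).1, hT0]
  -- At `y = 0` every `s i` vanishes, and then `s j (0, 0) = 0`.
  · simp only [hr, (hsT M).1, hT0]
  -- Only `s j (s i (t, 0), 0)` remains; the inner `T` gives back `s i (t, 0)` and the outer one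
  -- `t`.
  · simp only [hr, h1, h2, h3, (hsT M).1, hT]

variable [L.IsAlgebraic]

/-! ### Semi-abelian varieties are classically ideal determined -/

variable {V} in
/-- In a semi-abelian variety, an algebra with a split epimorphism `(p, s)` out of it is generated
by the kernel of `p` and the image of `s`. -/
theorem IsSemiAbelian.eq_top (hV : IsSemiAbelian.{u, v, w} V) {A B : Type w} [L.Structure A]
    [L.Structure B] [V.IsAlgebra A] [V.IsAlgebra B] (p : A →[L] B) (s : B →[L] A)
    (hps : ∀ z, p (s z) = z) (S : L.Substructure A) (hker : ∀ z, p z = (V.zero : B) → z ∈ S)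
    (hs : ∀ z, s z ∈ S) : S = ⊤ := by
  let s₀ : B →[L] S :=
    { toFun := fun z => ⟨s z, hs z⟩
      map_fun' := fun f xs => Subtype.ext (s.map_fun f xs)
      map_rel' := fun r => isEmptyElim r }
  -- The Split Short Five Lemma for the inclusion of `S` over the identity of `B`: the kernels agree
  -- since `S` contains that of `p`.
  have h := hV S B A B (p.comp S.subtype.toHom) s₀ p s S.subtype.toHom (Hom.id L B) hps hps
    (fun _ => rfl) (fun _ => rfl) Function.bijective_id
    ⟨fun _ hz => hz, fun _ _ _ _ h => Subtype.ext h, fun z hz => ⟨⟨z, hker z hz⟩, hz, rfl⟩⟩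
  refine eq_top_iff.2 fun z _ => ?_
  obtain ⟨z', rfl⟩ := h.2 z
  exact z'.2

/-- A semi-abelian variety is classically ideal determined. -/
theorem IsSemiAbelian.isClassicallyIdealDetermined
    (hV : IsSemiAbelian.{u, v, max u w} V) : IsClassicallyIdealDetermined.{u, v, max u w} V := by
  classical
  -- Lifting the generators puts the free algebras in the universe over which `hV` quantifies.
  let F₂ := Free.{u, v, max u w, max u w} V (ULift.{max u w} (Fin 2))
  let F₁ := Free.{u, v, max u w, max u w} V (ULift.{max u w} Unit)
  let g : ULift.{max u w} (Fin 2) → F₂ := fun i => Free.mk (Term.var i)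
  let g₁ : F₁ := Free.mk (Term.var ⟨()⟩)
  let p : F₂ →[L] F₁ := Free.lift fun _ => g₁
  let s : F₁ →[L] F₂ := Free.lift fun _ => g ⟨1⟩
  have hps : ∀ z, p (s z) = z := by
    have h : p.comp s = Hom.id L F₁ := Free.hom_ext fun _ => rfl
    exact DFunLike.congr_fun h
  let G : Set F₂ := {z | p z = (V.zero : F₁)} ∪ {g ⟨1⟩}
  have hs : ∀ z, s z ∈ Substructure.closure L G := by
    intro z
    have h1 : (Substructure.closure L G).comap s = ⊤ := by
      refine eq_top_iff.2 fun z _ => ?_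
      induction z using Quotient.inductionOn with
      | h t =>
        change Free.mk t ∈ _
        induction t with
        | var i => exact Substructure.subset_closure (Or.inr rfl)
        | func f ts ih =>
          rw [← Free.funMap_mk]
          exact Substructure.fun_mem _ f _ fun i => ih i (Substructure.mem_top _)
    have : z ∈ (Substructure.closure L G).comap s := h1 ▸ Substructure.mem_top z
    exact this
  have htop := hV.eq_top p s hps (Substructure.closure L G)
    (fun z hz => Substructure.subset_closure (Or.inl hz)) hs
  have hx : g ⟨0⟩ ∈ Substructure.closure L G := htop ▸ Substructure.mem_top _
  obtain ⟨t, ht⟩ := Substructure.mem_closure_iff_exists_term.1 hx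
  obtain ⟨n, e, t', rfl⟩ := exists_relabel_fin t
  rw [Term.realize_relabel] at ht
  -- Each `e i` is in the kernel of `p` or is the generator `y`. In the latter case its variable
  -- becomes the last one of the new term, and the unused slot `i` is filled with `0`.
  let k : Fin n → F₂ := fun i => if p (e i) = (V.zero : F₁) then e i else (V.zero : F₂)
  have hk : ∀ i, p (k i) = (V.zero : F₁) := fun i => by
    dsimp only [k]
    split_ifs with h
    · exact h
    · exact HomClass.map_constants p V.zero
  let S : Fin n → L.Term (ULift.{max u w} (Fin 2)) := fun i =>
    Quotient.out (s := freeSetoid V _) (k i)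
  have hS : ∀ i, Free.mk (S i) = k i := fun i => Free.mk_out _
  refine ⟨n, fun i => (S i).relabel ULift.down,
    t'.relabel fun i => if p (e i) = (V.zero : F₁) then Sum.inl i else Sum.inr (), ?_⟩
  intro M _ _
  refine ⟨fun i x => ?_, fun x y => ?_⟩
  · rw [Term.realize_relabel]
    -- Evaluation with both generators sent to `x` factors through `p`, which kills `k i`.
    let q : F₁ →[L] M := Free.lift fun _ => x
    have h2 : (Free.lift (fun _ => x) : F₂ →[L] M) = q.comp p := Free.hom_ext fun _ => rfl
    have h3 : ![x, x] ∘ ULift.down = fun _ : ULift.{max u w} (Fin 2) => x := by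
      funext ⟨j⟩
      fin_cases j <;> rfl
    rw [h3, ← Free.lift_mk (V := V), hS]
    change (Free.lift (fun _ => x) : F₂ →[L] M) (k i) = _
    rw [h2, Hom.comp_apply, hk]
    exact HomClass.map_constants q V.zero
  -- The expression of the first generator through `k` and `y` is carried to `M`.
  · let q : F₂ →[L] M := Free.lift (![x, y] ∘ ULift.down)
    have h4 := congrArg q ht
    rw [← HomClass.realize_term q] at h4
    rw [Term.realize_relabel]
    refine Eq.trans (congrArg (fun a => t'.realize a) (funext fun i => ?_)) h4
    simp only [Function.comp_apply]
    split_ifs with h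
    · simp only [Sum.elim_inl]
      rw [Term.realize_relabel, ← Free.lift_mk (V := V), hS]
      change q (k i) = q (e i)
      simp only [k, if_pos h]
    · have h5 : (e i : F₂) = g ⟨1⟩ := (e i).2.resolve_left h
      rw [h5]
      rfl

/-! ### Elements of `W + X + Y` as term values -/

/-- Every element of the coproduct `W + X + Y` is the value of a term at elements of `W`, `X`
and `Y`. -/
theorem Coprod.exists_realize {W : Type w₁} {X : Type w₂} {Y : Type w₃} [L.Structure W]
    [L.Structure X] [L.Structure Y] (z : V.Coprod (V.Coprod W X) Y) :
    ∃ (k m n : ℕ) (t : L.Term (Fin k ⊕ (Fin m ⊕ Fin n))) (c : Fin k → W) (a : Fin m → X)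
      (b : Fin n → Y), z = t.realize
        (Sum.elim (fun i => Coprod.inl V _ Y (Coprod.inl V W X (c i)))
          (Sum.elim (fun i => Coprod.inl V _ Y (Coprod.inr V W X (a i)))
            (fun i => Coprod.inr V _ Y (b i)))) := by
  let v : W ⊕ (X ⊕ Y) → V.Coprod (V.Coprod W X) Y :=
    Sum.elim (fun i => Coprod.inl V _ Y (Coprod.inl V W X i))
      (Sum.elim (fun i => Coprod.inl V _ Y (Coprod.inr V W X i)) (fun i => Coprod.inr V _ Y i))
  have hz : z ∈ Substructure.closure L (Set.range v) := by
    have hl : ∀ q, Coprod.inl V (V.Coprod W X) Y q ∈ Substructure.closure L (Set.range v) := by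
      intro q
      induction q using Quotient.inductionOn with
      | h t =>
        change Coprod.inl V _ Y (Coprod.mk V t) ∈ _
        induction t with
        | var i =>
          rcases i with i | i
          · exact Substructure.subset_closure ⟨Sum.inl i, rfl⟩
          · exact Substructure.subset_closure ⟨Sum.inr (Sum.inl i), rfl⟩
        | func f ts ih =>
          rw [← Coprod.funMap_mk, Hom.map_fun]
          exact Substructure.fun_mem _ f _ ih
    induction z using Quotient.inductionOn with
    | h t =>
      change Coprod.mk V t ∈ _
      induction t with
      | var i =>
        rcases i with i | i
        · exact hl i
        · exact Substructure.subset_closure ⟨Sum.inr (Sum.inr i), rfl⟩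
      | func f ts ih =>
        rw [← Coprod.funMap_mk]
        exact Substructure.fun_mem _ f _ ih
  rw [Substructure.mem_closure_iff_exists_term] at hz
  obtain ⟨t, rfl⟩ := hz
  obtain ⟨n, e, t, rfl⟩ := exists_relabel_fin t
  choose e' he' using fun i => (e i).2
  -- The variables are sorted by the summand their value comes from. An index determines its pair,
  -- so the three sets are finite.
  let I₁ := {p : Fin n × W // e' p.1 = Sum.inl p.2}
  let I₂ := {p : Fin n × X // e' p.1 = Sum.inr (Sum.inl p.2)}
  let I₃ := {p : Fin n × Y // e' p.1 = Sum.inr (Sum.inr p.2)}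
  have : Finite I₁ := Finite.of_injective (fun p : I₁ => p.1.1) fun p q h =>
    Subtype.ext (Prod.ext h (Sum.inl.inj (p.2.symm.trans ((congrArg e' h).trans q.2))))
  have : Finite I₂ := Finite.of_injective (fun p : I₂ => p.1.1) fun p q h =>
    Subtype.ext (Prod.ext h (Sum.inl.inj (Sum.inr.inj
      (p.2.symm.trans ((congrArg e' h).trans q.2)))))
  have : Finite I₃ := Finite.of_injective (fun p : I₃ => p.1.1) fun p q h =>
    Subtype.ext (Prod.ext h (Sum.inr.inj (Sum.inr.inj
      (p.2.symm.trans ((congrArg e' h).trans q.2)))))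
  let ρ : ∀ i, ∀ x, e' i = x → Fin (Nat.card I₁) ⊕ (Fin (Nat.card I₂) ⊕ Fin (Nat.card I₃)) :=
    fun i x h => match x, h with
    | Sum.inl x, h => Sum.inl (Finite.equivFin I₁ ⟨(i, x), h⟩)
    | Sum.inr (Sum.inl x), h => Sum.inr (Sum.inl (Finite.equivFin I₂ ⟨(i, x), h⟩))
    | Sum.inr (Sum.inr x), h => Sum.inr (Sum.inr (Finite.equivFin I₃ ⟨(i, x), h⟩))
  refine ⟨_, _, _, t.relabel fun i => ρ i _ rfl, fun j => ((Finite.equivFin I₁).symm j).1.2,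
    fun j => ((Finite.equivFin I₂).symm j).1.2, fun j => ((Finite.equivFin I₃).symm j).1.2, ?_⟩
  rw [Term.realize_relabel, Term.realize_relabel]
  congr 1
  funext i
  -- Stated for arbitrary `x` with `e' i = x`, so that a case split on `x` reduces `ρ`.
  have key : ∀ x (h : e' i = x), v x = Sum.elim
      (fun j => Coprod.inl V _ Y (Coprod.inl V W X ((Finite.equivFin I₁).symm j).1.2))
      (Sum.elim (fun j => Coprod.inl V _ Y (Coprod.inr V W X ((Finite.equivFin I₂).symm j).1.2))
        (fun j => Coprod.inr V _ Y ((Finite.equivFin I₃).symm j).1.2)) (ρ i x h) := by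
    rintro (x | x | x) h <;> simp [ρ, v]
  exact (he' i).symm.trans (key _ rfl)

/-! ### The two inclusions -/

/-- The commutator term, evaluated at the injected elements of `A + X + Y`, gives the preimage.
Killing `Y` or `X` turns it into an instance of one of the two identities, in `A + X` or `A + Y`. -/
theorem termCommutator_subset_oneWeightedCommutator {A : Type (max u w)} [L.Structure A]
    [V.IsAlgebra A] (X Y : L.Substructure A) :
    V.termCommutator X Y ⊆ (V.oneWeightedCommutator X Y : Set A) := by
  rintro z ⟨k, m, n, t, c, a, b, ht, ha, hb, rfl⟩
  refine ⟨t.realize (Sum.elim (fun i => Coprod.inl V _ Y (Coprod.inl V A X (c i)))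
    (Sum.elim (fun i => Coprod.inl V _ Y (Coprod.inr V A X ⟨a i, ha i⟩))
      (fun i => Coprod.inr V _ Y ⟨b i, hb i⟩))), ?_, ?_⟩
  · have hl := HomClass.map_constants (Pullback.fst (V.retraction A X) (V.retraction A Y)) V.zero
    have hr := HomClass.map_constants (Pullback.snd (V.retraction A X) (V.retraction A Y)) V.zero
    refine Subtype.ext (Prod.ext (Eq.trans ?_ hl.symm) (Eq.trans ?_ hr.symm))
    · change V.toCoprodLeft A X Y _ = _
      rw [← HomClass.realize_term]
      refine Eq.trans (congrArg (fun e => t.realize e) ?_) (ht (V.Coprod A X)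
        (fun i => Coprod.inl V A X (c i)) (fun i => Coprod.inr V A X ⟨a i, ha i⟩)
        (fun _ => (V.zero : V.Coprod A X))).2
      funext i
      rcases i with i | i | i <;> rfl
    · change V.toCoprodRight A X Y _ = _
      rw [← HomClass.realize_term]
      refine Eq.trans (congrArg (fun e => t.realize e) ?_) (ht (V.Coprod A Y)
        (fun i => Coprod.inl V A Y (c i)) (fun _ => (V.zero : V.Coprod A Y))
        (fun i => Coprod.inr V A Y ⟨b i, hb i⟩)).1
      funext i
      rcases i with i | i | i <;> rfl
  · rw [← HomClass.realize_term]
    congr 1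
    funext i
    rcases i with i | i | i <;> rfl

/-- Membership in the kernel gives equations in `A + X` and `A + Y`. Mapped to `A`, they are exactly
the three vanishing conditions under which the corrected term has the value of `t`. -/
theorem IsClassicallyIdealDetermined.oneWeightedCommutator_subset_termCommutator
    (hV : IsClassicallyIdealDetermined.{u, v, max u w} V) {A : Type (max u w)} [L.Structure A]
    [V.IsAlgebra A] (X Y : L.Substructure A) :
    (V.oneWeightedCommutator X Y : Set A) ⊆ V.termCommutator X Y := by
  rintro _ ⟨z, hz, rfl⟩
  obtain ⟨k, m, n, t, c, a, b, rfl⟩ := Coprod.exists_realize V z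
  obtain ⟨t', ht', h⟩ := hV.exists_isCommutatorTerm V t
  let p : V.Coprod A X →[L] A := Coprod.desc V (Hom.id L A) X.subtype.toHom
  let q : V.Coprod A Y →[L] A := Coprod.desc V (Hom.id L A) Y.subtype.toHom
  have hzl := congrArg (fun z => (Pullback.fst (V.retraction A X) (V.retraction A Y)) z) hz
  have hzr := congrArg (fun z => (Pullback.snd (V.retraction A X) (V.retraction A Y)) z) hz
  simp only [HomClass.map_constants] at hzl hzr
  change V.toCoprodLeft A X Y _ = _ at hzl
  change V.toCoprodRight A X Y _ = _ at hzr
  -- Applying `[1, x]`, `[1, y]` and `[1, 0]` yields `t(c, a, 0) = 0`, `t(c, 0, b) = 0` and `t(c, 0,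
  -- 0) = 0` in `A`.
  have h1 := congrArg p hzl
  have h2 := congrArg q hzr
  have h3 := congrArg (V.retraction A X) hzl
  simp only [← HomClass.realize_term, HomClass.map_constants] at h1 h2 h3
  refine ⟨k, m, n, t', c, fun i => a i, fun i => b i, ht', fun i => (a i).2, fun i => (b i).2, ?_⟩
  rw [h A c (fun i => a i) (fun i => b i), ← HomClass.realize_term]
  · congr 1
    funext i
    rcases i with i | i | i <;> rfl
  · refine Eq.trans (congrArg (fun e => t.realize e) ?_) h2
    funext i
    rcases i with i | i | i
    · rfl
    · exact (HomClass.map_constants q V.zero).symm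
    · rfl
  · refine Eq.trans (congrArg (fun e => t.realize e) ?_) h1
    funext i
    rcases i with i | i | i
    · rfl
    · rfl
    · exact (HomClass.map_constants p V.zero).symm
  · refine Eq.trans (congrArg (fun e => t.realize e) ?_) h3
    funext i
    rcases i with i | i | i
    · rfl
    · rfl
    · exact (HomClass.map_constants (V.retraction A X) V.zero).symm

end PointedVariety

theorem mainTheorem3 {L : FirstOrder.Language.{u, v}} [L.IsAlgebraic]
    (V : PointedVariety L)
    (hV : PointedVariety.IsSemiAbelian.{u, v, max u w} V ∨
      PointedVariety.IsClassicallyIdealDetermined.{u, v, max u w} V)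
    (A : Type (max u w)) [L.Structure A] [V.IsAlgebra A] (X Y : L.Substructure A) :
    V.termCommutator X Y = (V.oneWeightedCommutator X Y : Set A) := by
  have h : PointedVariety.IsClassicallyIdealDetermined.{u, v, max u w} V :=
    hV.elim (PointedVariety.IsSemiAbelian.isClassicallyIdealDetermined.{u, v, w} V) id
  exact Set.Subset.antisymm
    (PointedVariety.termCommutator_subset_oneWeightedCommutator.{u, v, w} V X Y)
    (h.oneWeightedCommutator_subset_termCommutator.{u, v, w} V X Y)
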